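/- Let $X$ be a metric Peano continuum, i.e. a metric space that is the image of $[0,1]$ under some continuous surjective map $[0,1]\to X$. For $\varepsilon>0$ let $S_X(\varepsilon)$ be the smallest cardinality of a cover of $X$ by connected subsets of diameter $\le\varepsilon$. A function $f:[0,1]\to X$ is called $\beta$-Hölder (for a real number $\beta\ge 0$) if there is a constant $C\ge 0$ with $d(f(s),f(t))\le C\,|s-t|^{\beta}$ for all $s,t\in[0,1]$, where $0^0=1$. Define, as elements of $[0,\infty]$, $$\mathsf{S\text{-}Dim}(X)=\limsup_{\varepsilon\to0^+}\frac{\ln S_X(\varepsilon)}{\ln(1/\varepsilon)},\qquad \mathsf{H\ddot o\text{-}Dim}(X)=\inf\bigl\{\alpha\in(0,\infty]:\text{there is a surjective }\tfrac1\alpha\text{-Hölder function }f:[0,1]\to X\bigr\},$$ where $\tfrac1\infty=0$. Then $$\mathsf{S\text{-}Dim}(X)\le\mathsf{H\ddot o\text{-}Dim}(X)\le 2\cdot\mathsf{S\text{-}Dim}(X).$$ -/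

import Mathlib

open Filter Topology
open scoped ENNReal NNReal

/-- A Peano continuum: a Hausdorff space that is a continuous image of the interval `[0,1]`. -/
def IsPeanoContinuum (X : Type*) [TopologicalSpace X] : Prop :=
  T2Space X ∧ ∃ f : unitInterval → X, Continuous f ∧ Function.Surjective f

/-- `𝒞` is a cover of `X` by connected subsets of diameter at most `ε`. -/
def IsConnectedCover {X : Type*} [MetricSpace X] (ε : ℝ) (𝒞 : Set (Set X)) : Prop :=
  ⋃₀ 𝒞 = Set.univ ∧ ∀ A ∈ 𝒞, IsConnected A ∧ Metric.ediam A ≤ ENNReal.ofReal ε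

/-- The Sierpiński function `S_X(ε)`: the smallest cardinality of a cover of `X` by connected
subsets of diameter at most `ε` (it is `⊤` if there is no finite cover of this kind). -/
noncomputable def sierpinskiFunction (X : Type*) [MetricSpace X] (ε : ℝ) : ℕ∞ :=
  sInf {n : ℕ∞ | ∃ 𝒞 : Set (Set X), IsConnectedCover ε 𝒞 ∧ 𝒞.encard = n}

/-- The `S`-dimension: the upper limit of `ln S_X(ε) / ln (1/ε)` as `ε` tends to `0` from the
right, an extended real number. -/
noncomputable def sDim (X : Type*) [MetricSpace X] : EReal :=
  limsup (fun ε : ℝ =>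
    ENNReal.log (sierpinskiFunction X ε : ℝ≥0∞) / ((Real.log (1 / ε) : ℝ) : EReal)) (𝓝[>] 0)

/-- The Hölder dimension: the infimum of the `α ∈ (0,∞]` for which there is a surjective
`1/α`-Hölder function `[0,1] → X`; here `1/∞ = 0`. -/
noncomputable def holderDim (X : Type*) [MetricSpace X] : ℝ≥0∞ :=
  sInf {α : ℝ≥0∞ | 0 < α ∧ ∃ f : unitInterval → X, Function.Surjective f ∧
    ∃ C : ℝ≥0, HolderWith C (1 / α).toNNReal f}

/-!
The lower bound is elementary: a `1 / α`-Hölder map of `[0, 1]` onto `X` turns a subdivision of the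
interval into about `ε⁻ᵅ` equal parts into a cover of `X` by connected sets of diameter at most `ε`
(`HolderWith.sierpinskiFunction_le`).

For the upper bound let `a > S-Dim X` and `α > 2 a`. There are covers `U n` of `X` by about `2ᵃⁿ`
closed connected sets of diameter at most a constant times `2⁻ⁿ` (`exists_isConnectedTower`). By
compactness (`exists_surjective_limit`) it is enough to find, for each `M`, a finite walk through
points of `X` which is dense at the scale `2⁻ᴹ` and which, for every `m ≤ M`, can be cut into at most
`K m` pieces of diameter about `2⁻ᵐ`, where `∑ K m * 2⁻ᵅᵐ` converges: a walk of this kind can be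
scheduled so that every passage to the next piece of scale `2⁻ᵐ` takes the time `c * 2⁻ᵅᵐ`
(`exists_parametrization`), which makes it approximately `1 / α`-Hölder.

The walk rests on two facts.

* Two points in a member of `U n` can be joined by a walk which needs only about `(U m).card` pieces
  at each scale `m > n` simultaneously, not the product of these numbers over all levels
  (`IsConnectedTower.exists_isStepWalk`). It comes from refining a chain of sets level by level and
  cutting out all loops at each level (`IsConnectedTower.exists_isMultiscaleChain`).
* Every member of `U (n + 1)` is attached to a parent in `U n` that it meets. A depth-first tour of
  the resulting tree uses two such walks for each member of each cover, so at scale `2⁻ᵐ` it has about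
  `(U m).card * ∑ i ≤ m, (U i).card` pieces, which is about `2²ᵃᵐ`; this is where the factor `2`
  of the theorem comes from (`IsParentMap.exists_tour`, `IsParentMap.sum_tourPieces_le`).
-/

/-! ### Chains of connected sets -/

/-- Any two points of a connected set `A` are linked by a chain of members of a finite closed cover,
successive ones meeting in `A`. Closedness is essential: disjoint connected sets can cover `A`. -/
theorem IsPreconnected.reflTransGen_of_closed_cover {X : Type*} [TopologicalSpace X] {A : Set X}
    (hA : IsPreconnected A) {U : Finset (Set X)} (hcl : ∀ B ∈ U, IsClosed B)
    (hcov : ∀ z, ∃ B ∈ U, z ∈ B) {x y : X} (hx : x ∈ A) (hy : y ∈ A) {B₀ : Set X} (hB₀ : B₀ ∈ U)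
    (hxB : x ∈ B₀) :
    ∃ B ∈ U, y ∈ B ∧
      Relation.ReflTransGen (fun C D => D ∈ U ∧ (A ∩ (C ∩ D)).Nonempty) B₀ B := by
  classical
  set S : Set X → Set X → Prop := fun C D => D ∈ U ∧ (A ∩ (C ∩ D)).Nonempty with hS
  by_contra hcon
  push Not at hcon
  have hc1 : IsClosed (⋃ B ∈ U.filter (fun B => Relation.ReflTransGen S B₀ B), B) :=
    isClosed_biUnion_finset fun B hB => hcl B (Finset.mem_filter.1 hB).1
  have hc2 : IsClosed (⋃ B ∈ U.filter (fun B => ¬ Relation.ReflTransGen S B₀ B), B) :=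
    isClosed_biUnion_finset fun B hB => hcl B (Finset.mem_filter.1 hB).1
  have key := isPreconnected_closed_iff.1 hA _ _ hc1 hc2 ?_ ?_ ?_
  · obtain ⟨z, hzA, hz1, hz2⟩ := key
    simp only [Set.mem_iUnion, Finset.mem_filter, exists_prop] at hz1 hz2
    obtain ⟨C, ⟨_, hC⟩, hzC⟩ := hz1
    obtain ⟨D, ⟨hDU, hD⟩, hzD⟩ := hz2
    exact hD (hC.tail ⟨hDU, z, hzA, hzC, hzD⟩)
  · intro z _
    obtain ⟨B, hB, hzB⟩ := hcov z
    by_cases h : Relation.ReflTransGen S B₀ B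
    · exact Or.inl (Set.mem_biUnion (Finset.mem_coe.2 (Finset.mem_filter.2 ⟨hB, h⟩)) hzB)
    · exact Or.inr (Set.mem_biUnion (Finset.mem_coe.2 (Finset.mem_filter.2 ⟨hB, h⟩)) hzB)
  · exact ⟨x, hx, Set.mem_biUnion
      (Finset.mem_coe.2 (Finset.mem_filter.2 ⟨hB₀, Relation.ReflTransGen.refl⟩)) hxB⟩
  · obtain ⟨B, hB, hyB⟩ := hcov y
    exact ⟨y, hy, Set.mem_biUnion
      (Finset.mem_coe.2 (Finset.mem_filter.2 ⟨hB, hcon B hB hyB⟩)) hyB⟩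

theorem Relation.ReflTransGen.exists_seq {V : Type*} {S : V → V → Prop} {a b : V}
    (h : Relation.ReflTransGen S a b) :
    ∃ (r : ℕ) (s : ℕ → V), s 0 = a ∧ s r = b ∧ ∀ j < r, S (s j) (s (j + 1)) := by
  induction h with
  | refl => exact ⟨0, fun _ => a, rfl, rfl, by simp⟩
  | @tail b c _ hbc ih =>
    obtain ⟨r, s, h0, hr, hs⟩ := ih
    refine ⟨r + 1, fun j => if j ≤ r then s j else c, by simp [h0], by simp, fun j hj => ?_⟩
    rcases Nat.lt_or_ge j r with h | h
    · simpa [h.le, Nat.succ_le_of_lt h] using hs j h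
    · obtain rfl : j = r := by omega
      simpa [hr] using hbc

/-- `s` is a chain of length `r + 1` from `x` to `y` of members of `U`, each of which is labelled by
an index `i ≤ k` such that it meets `A i`; the indices increase along the chain. -/
structure IsLabelledChain {X : Type*} (A : ℕ → Set X) (k : ℕ) (U : Finset (Set X)) (x y : X)
    (r : ℕ) (s : ℕ → ℕ × Set X) : Prop where
  left_mem : x ∈ (s 0).2
  right_mem : y ∈ (s r).2
  index_le : ∀ j ≤ r, (s j).1 ≤ k
  mem : ∀ j ≤ r, (s j).2 ∈ U
  meets : ∀ j ≤ r, (A (s j).1 ∩ (s j).2).Nonempty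
  step_le : ∀ j < r, (s j).1 ≤ (s (j + 1)).1
  link : ∀ j < r, ((s j).2 ∩ (s (j + 1)).2).Nonempty

theorem IsLabelledChain.index_mono {X : Type*} {A : ℕ → Set X} {k : ℕ} {U : Finset (Set X)}
    {x y : X} {r : ℕ} {s : ℕ → ℕ × Set X} (h : IsLabelledChain A k U x y r s) {i j : ℕ}
    (hij : i ≤ j) (hj : j ≤ r) : (s i).1 ≤ (s j).1 := by
  induction j, hij using Nat.le_induction with
  | base => exact le_rfl
  | succ j _ ih => exact (ih (by omega)).trans (h.step_le j (by omega))

theorem exists_isLabelledChain {X : Type*} [TopologicalSpace X] {A : ℕ → Set X} {k : ℕ}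
    (hA : ∀ i ≤ k, IsPreconnected (A i)) (hmeet : ∀ i < k, (A i ∩ A (i + 1)).Nonempty)
    {U : Finset (Set X)} (hcl : ∀ B ∈ U, IsClosed B) (hcov : ∀ z, ∃ B ∈ U, z ∈ B) {x y : X}
    (hx : x ∈ A 0) (hy : y ∈ A k) : ∃ r s, IsLabelledChain A k U x y r s := by
  obtain ⟨B₀, hB₀, hxB₀⟩ := hcov x
  set S : ℕ × Set X → ℕ × Set X → Prop := fun u v => u.1 ≤ v.1 ∧ v.1 ≤ k ∧ v.2 ∈ U ∧
    (u.2 ∩ v.2).Nonempty ∧ (A v.1 ∩ v.2).Nonempty with hS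
  have lift : ∀ i ≤ k, ∀ B C, Relation.ReflTransGen
      (fun C D => D ∈ U ∧ (A i ∩ (C ∩ D)).Nonempty) B C →
      Relation.ReflTransGen S (i, B) (i, C) := by
    intro i hi B C h
    refine Relation.ReflTransGen.lift (fun B => (i, B)) ?_ _ _ h
    rintro C D ⟨hD, z, hzA, hzC, hzD⟩
    exact ⟨le_rfl, hi, hD, ⟨z, hzC, hzD⟩, ⟨z, hzA, hzD⟩⟩
  have reach : ∀ i ≤ k, ∀ z ∈ A i, ∃ B ∈ U, z ∈ B ∧ Relation.ReflTransGen S (0, B₀) (i, B) := by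
    intro i
    induction i with
    | zero =>
      intro hi z hz
      obtain ⟨B, hB, hzB, h⟩ := (hA 0 hi).reflTransGen_of_closed_cover hcl hcov hx hz hB₀ hxB₀
      exact ⟨B, hB, hzB, lift 0 hi _ _ h⟩
    | succ i ih =>
      intro hi z hz
      obtain ⟨w, hw, hw'⟩ := hmeet i hi
      obtain ⟨B, hB, hwB, h⟩ := ih (by omega) w hw
      obtain ⟨C, hC, hzC, h'⟩ := (hA (i + 1) hi).reflTransGen_of_closed_cover hcl hcov hw' hz hB hwB
      exact ⟨C, hC, hzC, (h.tail ⟨by simp, hi, hB, ⟨w, hwB, hwB⟩, ⟨w, hw', hwB⟩⟩).trans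
        (lift _ hi _ _ h')⟩
  obtain ⟨B, hB, hyB, h⟩ := reach k le_rfl y hy
  obtain ⟨r, s, h0, hr, hs⟩ := h.exists_seq
  have good : ∀ j ≤ r, (s j).1 ≤ k ∧ (s j).2 ∈ U ∧ (A (s j).1 ∩ (s j).2).Nonempty := by
    rintro (_ | j) hj
    · rw [h0]; exact ⟨Nat.zero_le _, hB₀, ⟨x, hx, hxB₀⟩⟩
    · obtain ⟨_, h1, h2, _, h3⟩ := hs j hj
      exact ⟨h1, h2, h3⟩
  exact ⟨r, s, by rwa [h0], by rwa [hr], fun j hj => (good j hj).1, fun j hj => (good j hj).2.1,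
    fun j hj => (good j hj).2.2, fun j hj => (hs j hj).1, fun j hj => (hs j hj).2.2.2.1⟩

/-- A labelled chain can be chosen so that no member of `U` occurs twice: in a chain of minimal
length there is no loop left to cut out. -/
theorem exists_isLabelledChain_injOn {X : Type*} {A : ℕ → Set X} {k : ℕ} {U : Finset (Set X)}
    {x y : X} (h : ∃ r s, IsLabelledChain A k U x y r s) :
    ∃ r s, IsLabelledChain A k U x y r s ∧ ∀ p q, p < q → q ≤ r → (s p).2 ≠ (s q).2 := by
  classical
  obtain ⟨s, hs⟩ := Nat.find_spec h
  refine ⟨Nat.find h, s, hs, fun p q hpq hq heq => ?_⟩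
  generalize hr : Nat.find h = r at hs hq
  refine Nat.find_min h (m := r - (q - p)) (by omega)
    ⟨fun j => if j ≤ p then s j else s (j + (q - p)), ?_⟩
  have hle : ∀ j, j ≤ r - (q - p) → p < j → j + (q - p) ≤ r := by intro j _ _; omega
  refine ⟨by simpa using hs.left_mem, ?_, ?_, ?_, ?_, ?_, ?_⟩
  · rcases hq.eq_or_lt with rfl | hlt
    · have : q - (q - p) ≤ p := by omega
      have h2 : q - (q - p) = p := by omega
      simp only [h2, le_refl, if_true, heq]
      exact hs.right_mem
    · have h1 : ¬ r - (q - p) ≤ p := by omega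
      have h2 : r - (q - p) + (q - p) = r := by omega
      simpa only [h1, if_false, h2] using hs.right_mem
  · intro j hj
    split_ifs with hjp
    · exact hs.index_le _ (by omega)
    · exact hs.index_le _ (by omega)
  · intro j hj
    split_ifs with hjp
    · exact hs.mem _ (by omega)
    · exact hs.mem _ (by omega)
  · intro j hj
    split_ifs with hjp
    · exact hs.meets _ (by omega)
    · exact hs.meets _ (by omega)
  · intro j hj
    split_ifs with h1 h2 h2
    · exact hs.step_le _ (by omega)
    · exact hs.index_mono (by omega) (by omega)
    · omega
    · exact hs.index_mono (by omega) (by omega)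
  · intro j hj
    split_ifs with h1 h2 h2
    · exact hs.link _ (by omega)
    · obtain rfl : j = p := by omega
      have h3 : j + 1 + (q - j) = q + 1 := by omega
      rw [h3, heq]
      exact hs.link _ (by omega)
    · omega
    · have h3 : j + 1 + (q - p) = j + (q - p) + 1 := by omega
      rw [h3]
      exact hs.link _ (by omega)

/-- `U n`, for `n : ℕ`, are finite covers of `X` by closed connected sets, and the members of `U n`
have diameter at most `R * 2⁻ⁿ`; the coarsest cover is `{X}`. -/
structure IsConnectedTower {X : Type*} [MetricSpace X] (R : ℝ) (U : ℕ → Finset (Set X)) :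
    Prop where
  zero : U 0 = {Set.univ}
  isClosed : ∀ n, ∀ B ∈ U n, IsClosed B
  isConnected : ∀ n, ∀ B ∈ U n, IsConnected B
  cover : ∀ n z, ∃ B ∈ U n, z ∈ B
  dist_le : ∀ n, ∀ B ∈ U n, ∀ x ∈ B, ∀ y ∈ B, dist x y ≤ R * (1 / 2) ^ n

/-- A chain of nested choices joining `x` and `y` in the vicinity of `A`: the `j`-th link
(`0 ≤ j ≤ k`) picks a member `σ j m` of each cover `U m`, `n < m ≤ M`, such that members of
successive levels meet, and successive links meet at the finest level `M`. At each level, each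
member of the cover is visited during a single block of consecutive links. -/
structure IsMultiscaleChain {X : Type*} (U : ℕ → Finset (Set X)) (n M : ℕ) (A : Set X) (x y : X)
    (k : ℕ) (σ : ℕ → ℕ → Set X) : Prop where
  base : ∀ j ≤ k, σ j n = A
  mem : ∀ j ≤ k, ∀ m, n < m → m ≤ M → σ j m ∈ U m
  meets : ∀ j ≤ k, ∀ m, n ≤ m → m < M → (σ j m ∩ σ j (m + 1)).Nonempty
  left_mem : x ∈ σ 0 M
  right_mem : y ∈ σ k M
  link : ∀ j < k, (σ j M ∩ σ (j + 1) M).Nonempty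
  block : ∀ m, n < m → m ≤ M → ∀ i j l, i ≤ j → j ≤ l → l ≤ k → σ i m = σ l m → σ j m = σ i m

/-- A chain for the level `M` is refined to one for the level `M + 1` by chains inside its links.
Cutting out the loops of the refined chain keeps only some of its links, in their order, and so does
not spoil the blocks at the coarser levels. -/
theorem IsConnectedTower.exists_isMultiscaleChain {X : Type*} [MetricSpace X] {R : ℝ}
    {U : ℕ → Finset (Set X)} (hU : IsConnectedTower R U) {n M : ℕ} (hM : n ≤ M) {A : Set X}
    (hA : A ∈ U n) {x y : X} (hx : x ∈ A) (hy : y ∈ A) :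
    ∃ k σ, IsMultiscaleChain U n M A x y k σ := by
  induction M, hM using Nat.le_induction with
  | base =>
    exact ⟨0, fun _ _ => A, by simp, by intros; omega, by intros; omega, hx, hy, by simp,
      by intros; rfl⟩
  | succ M hM ih =>
    obtain ⟨k, σ, h⟩ := ih
    have hconn : ∀ i ≤ k, IsPreconnected (σ i M) := by
      intro i hi
      rcases hM.eq_or_lt with rfl | hlt
      · rw [h.base i hi]
        exact (hU.isConnected _ _ hA).isPreconnected
      · exact (hU.isConnected M _ (h.mem i hi M hlt le_rfl)).isPreconnected
    obtain ⟨r, s, hs, hinj⟩ := exists_isLabelledChain_injOn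
      (exists_isLabelledChain (A := fun i => σ i M) hconn h.link (hU.isClosed (M + 1))
        (hU.cover (M + 1)) h.left_mem h.right_mem)
    refine ⟨r, fun j m => if m ≤ M then σ (s j).1 m else (s j).2, ?_, ?_, ?_, ?_, ?_, ?_, ?_⟩
    · intro j hj
      simpa [hM] using h.base _ (hs.index_le j hj)
    · intro j hj m hnm hm
      split_ifs with hmM
      · exact h.mem _ (hs.index_le j hj) m hnm hmM
      · obtain rfl : m = M + 1 := by omega
        exact hs.mem j hj
    · intro j hj m hnm hm
      rw [if_pos (by omega)]
      split_ifs with hmM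
      · exact h.meets _ (hs.index_le j hj) m hnm hmM
      · obtain rfl : m = M := by omega
        exact hs.meets j hj
    · simpa using hs.left_mem
    · simpa using hs.right_mem
    · simpa using hs.link
    · intro m hnm hm i j l hij hjl hl
      split_ifs with hmM
      · exact h.block m hnm hmM _ _ _ (hs.index_mono hij (by omega)) (hs.index_mono hjl hl)
          (hs.index_le l hl)
      · intro heq
        rcases (hij.trans hjl).eq_or_lt with h1 | h1
        · obtain rfl : i = j := by omega
          rfl
        · exact absurd heq (hinj i l h1 hl)

/-! ### Walks with few pieces at each scale -/

/-- `IsStepWalk δ x l y`: the nonempty list `l` starts at `x`, ends at `y`, and its steps have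
length at most `δ`. -/
inductive IsStepWalk {X : Type*} [MetricSpace X] (δ : ℝ) : X → List X → X → Prop
  | single (x : X) : IsStepWalk δ x [x] x
  | cons {x y z : X} {l : List X} (h : dist x y ≤ δ) (hl : IsStepWalk δ y l z) :
      IsStepWalk δ x (x :: l) z

theorem IsStepWalk.append {X : Type*} [MetricSpace X] {δ : ℝ} {x y y' z : X} {l l' : List X}
    (h : IsStepWalk δ x l y) (hy : dist y y' ≤ δ) (h' : IsStepWalk δ y' l' z) :
    IsStepWalk δ x (l ++ l') z := by
  induction h with
  | single x => exact .cons hy h'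
  | cons hd _ ih => exact .cons hd (ih hy)

theorem IsStepWalk.ne_nil {X : Type*} [MetricSpace X] {δ : ℝ} {x y : X} {l : List X}
    (h : IsStepWalk δ x l y) : l ≠ [] := by
  cases h <;> simp

theorem IsStepWalk.map_range {X : Type*} [MetricSpace X] {δ : ℝ} {z : ℕ → X} {k : ℕ}
    (h : ∀ j < k, dist (z j) (z (j + 1)) ≤ δ) :
    IsStepWalk δ (z 0) ((List.range (k + 1)).map z) (z k) := by
  induction k with
  | zero => simpa using IsStepWalk.single (z 0)
  | succ k ih =>
    rw [List.range_succ, List.map_append]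
    exact (ih fun j hj => h j (by omega)).append (h k (by omega)) (.single _)

theorem IsStepWalk.dist_getElem_le {X : Type*} [MetricSpace X] {δ : ℝ} {x y : X} {l : List X}
    (h : IsStepWalk δ x l y) (i : ℕ) (hi : i + 1 < l.length) : dist l[i] l[i + 1] ≤ δ := by
  induction h generalizing i with
  | single x => simp at hi
  | @cons x y z l hd hl ih =>
    rcases i with _ | i
    · cases hl <;> simpa using hd
    · simpa using ih i (by simpa using hi)

/-- `HasPieces r K l`: the list `l` can be cut into at most `K` consecutive pieces, each of
diameter at most `r`. The piece of the `i`-th entry is recorded by its number `lam i < K`. -/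
def HasPieces {X : Type*} [MetricSpace X] (r : ℝ) (K : ℕ) (l : List X) : Prop :=
  ∃ lam : ℕ → ℕ, Monotone lam ∧ (∀ i < l.length, lam i < K) ∧
    ∀ i j (hi : i < l.length) (hj : j < l.length), lam i = lam j → dist l[i] l[j] ≤ r

theorem HasPieces.one {X : Type*} [MetricSpace X] {r : ℝ} {l : List X}
    (h : ∀ a ∈ l, ∀ b ∈ l, dist a b ≤ r) : HasPieces r 1 l :=
  ⟨fun _ => 0, monotone_const, by simp, fun _ _ _ _ _ =>
    h _ (List.getElem_mem _) _ (List.getElem_mem _)⟩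

theorem HasPieces.mono {X : Type*} [MetricSpace X] {r : ℝ} {K K' : ℕ} {l : List X}
    (h : HasPieces r K l) (hK : K ≤ K') : HasPieces r K' l := by
  obtain ⟨lam, h1, h2, h3⟩ := h
  exact ⟨lam, h1, fun i hi => (h2 i hi).trans_le hK, h3⟩

theorem HasPieces.append {X : Type*} [MetricSpace X] {r : ℝ} {K K' : ℕ} {l l' : List X}
    (h : HasPieces r K l) (h' : HasPieces r K' l') : HasPieces r (K + K') (l ++ l') := by
  obtain ⟨lam, hm, hK, hd⟩ := h
  obtain ⟨lam', hm', hK', hd'⟩ := h'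
  refine ⟨fun i => if i < l.length then lam i else K + lam' (i - l.length), ?_, ?_, ?_⟩
  · intro i j hij
    dsimp only
    split_ifs with h1 h2 h2
    · exact hm hij
    · exact (hK i h1).le.trans (Nat.le_add_right _ _)
    · omega
    · exact Nat.add_le_add_left (hm' (by omega)) _
  · intro i hi
    rw [List.length_append] at hi
    dsimp only
    split_ifs with h1
    · exact (hK i h1).trans_le (Nat.le_add_right _ _)
    · exact Nat.add_lt_add_left (hK' _ (by omega)) _
  · intro i j hi hj
    rw [List.length_append] at hi hj
    simp only [List.getElem_append]
    split_ifs with h1 h2 h2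
    · exact hd i j h1 h2
    · intro heq
      have := hK i h1
      omega
    · intro heq
      have := hK j h2
      omega
    · intro heq
      exact hd' _ _ _ _ (by omega)

/-- A labelling of `0, …, k` by members of a finite set such that each label occupies a block of
consecutive indices cuts the list `z 0, …, z k` into at most as many pieces as there are labels. -/
theorem HasPieces.map_range {X W : Type*} [MetricSpace X] {r : ℝ} {z : ℕ → X} {k : ℕ}
    {V : Finset W} {c : ℕ → W} (hc : ∀ j ≤ k, c j ∈ V)
    (hblock : ∀ i j l, i ≤ j → j ≤ l → l ≤ k → c i = c l → c j = c i)
    (hd : ∀ i ≤ k, ∀ j ≤ k, c i = c j → dist (z i) (z j) ≤ r) :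
    HasPieces r V.card ((List.range (k + 1)).map z) := by
  classical
  -- The piece of `i` is counted by the labels of `0, …, i` other than `c i`.
  set I : ℕ → Finset W := fun i => (Finset.range (i + 1)).image c with hI
  have hmono : Monotone I := fun i j hij =>
    Finset.image_subset_image (Finset.range_mono (by omega))
  have hmem : ∀ i, c i ∈ I i := fun i =>
    Finset.mem_image_of_mem _ (Finset.self_mem_range_succ i)
  have hpos : ∀ i, 0 < (I i).card := fun i => Finset.card_pos.2 ⟨_, hmem i⟩
  have key : ∀ i j, i ≤ j → j ≤ k → (I i).card = (I j).card → c i = c j := by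
    intro i j hij hj h
    have h1 : I i = I j := Finset.eq_of_subset_of_card_le (hmono hij) h.ge
    have h2 : c j ∈ I i := h1 ▸ hmem j
    obtain ⟨i', hi', h3⟩ := Finset.mem_image.1 h2
    have hi'' : i' ≤ i := by simpa [Nat.lt_succ_iff] using hi'
    rw [hblock i' i j hi'' hij hj h3, h3]
  refine ⟨fun i => (I i).card - 1, fun i j hij =>
    Nat.sub_le_sub_right (Finset.card_le_card (hmono hij)) 1, ?_, ?_⟩
  · intro i hi
    have hi' : i ≤ k := by simpa [Nat.lt_succ_iff] using hi
    have : (I i).card ≤ V.card := Finset.card_le_card (by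
      intro w hw
      obtain ⟨j, hj, rfl⟩ := Finset.mem_image.1 hw
      exact hc j (by simp at hj; omega))
    have := hpos i
    dsimp only
    omega
  · intro i j hi hj heq
    have hi' : i ≤ k := by simpa [Nat.lt_succ_iff] using hi
    have hj' : j ≤ k := by simpa [Nat.lt_succ_iff] using hj
    have heq' : (I i).card = (I j).card := by
      have := hpos i
      have := hpos j
      dsimp only at heq
      omega
    simp only [List.getElem_map, List.getElem_range]
    rcases le_total i j with h | h
    · exact hd i hi' j hj' (key i j h hj' heq')
    · exact hd i hi' j hj' (key j i h hi' heq'.symm).symm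

/-- The distances add up to a geometric series along the levels `m, …, M`. -/
theorem IsMultiscaleChain.dist_le {X : Type*} [MetricSpace X] {R : ℝ}
    {U : ℕ → Finset (Set X)} (hU : IsConnectedTower R U) {n M k : ℕ} {A : Set X} (hA : A ∈ U n)
    {x y : X} {σ : ℕ → ℕ → Set X} (h : IsMultiscaleChain U n M A x y k σ) {j : ℕ} (hj : j ≤ k)
    {m : ℕ} (hn : n ≤ m) (hm : m ≤ M) {u z : X} (hu : u ∈ σ j m) (hz : z ∈ σ j M) :
    dist z u ≤ R * (2 * (1 / 2) ^ m - (1 / 2) ^ M) := by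
  have hmem : ∀ m, n ≤ m → m ≤ M → σ j m ∈ U m := by
    intro m hn hm
    rcases hn.eq_or_lt with rfl | hlt
    · rwa [h.base j hj]
    · exact h.mem j hj m hlt hm
  obtain ⟨d, rfl⟩ := Nat.exists_eq_add_of_le hm
  clear hm
  induction d generalizing m u with
  | zero =>
    refine (hU.dist_le _ _ (hmem m hn le_rfl) z hz u hu).trans (le_of_eq ?_)
    simp only [add_zero]
    ring
  | succ d ih =>
    obtain ⟨v, hv, hv'⟩ := h.meets j hj m hn (by omega)
    have e : m + (d + 1) = m + 1 + d := by omega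
    rw [e] at h hmem hz ⊢
    have h1 := ih (m := m + 1) (by omega) hv' h hz hmem
    have h2 := hU.dist_le _ _ (hmem m hn (by omega)) v hv u hu
    have h3 := dist_triangle z v u
    have h4 : ((1 : ℝ) / 2) ^ (m + 1) = (1 / 2) ^ m / 2 := by ring
    rw [h4] at h1
    linarith

theorem IsConnectedTower.nonneg {X : Type*} [MetricSpace X] [Nonempty X] {R : ℝ}
    {U : ℕ → Finset (Set X)} (hU : IsConnectedTower R U) : 0 ≤ R := by
  obtain ⟨x⟩ := ‹Nonempty X›
  obtain ⟨B, hB, hx⟩ := hU.cover 0 x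
  simpa using hU.dist_le 0 B hB x hx x hx

/-- Two points of a member `A` of `U n` are joined by a walk with steps of scale `2⁻ᴹ` that stays
close to `A` and that, for each `m` between `n` and `M`, consists of about `(U m).card` pieces of
scale `2⁻ᵐ`. -/
theorem IsConnectedTower.exists_isStepWalk {X : Type*} [MetricSpace X] {R : ℝ}
    {U : ℕ → Finset (Set X)} (hU : IsConnectedTower R U) {n M : ℕ} (hM : n ≤ M) {A : Set X}
    (hA : A ∈ U n) {x y : X} (hx : x ∈ A) (hy : y ∈ A) :
    ∃ l, IsStepWalk (2 * R * (1 / 2) ^ M) x l y ∧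
      (∀ a ∈ l, ∀ u ∈ A, dist a u ≤ 2 * R * (1 / 2) ^ n) ∧
      ∀ m, n < m → m ≤ M → HasPieces (4 * R * (1 / 2) ^ m) ((U m).card + 2) l := by
  have : Nonempty X := ⟨x⟩
  have hR := hU.nonneg
  obtain ⟨k, σ, h⟩ := hU.exists_isMultiscaleChain hM hA hx hy
  have hmem : ∀ j ≤ k, ∀ m, n ≤ m → m ≤ M → σ j m ∈ U m := by
    intro j hj m hn hm
    rcases hn.eq_or_lt with rfl | hlt
    · rwa [h.base j hj]
    · exact h.mem j hj m hlt hm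
  have hex : ∀ j, ∃ z, j ≤ k → z ∈ σ j M := by
    intro j
    by_cases hj : j ≤ k
    · obtain ⟨z, hz⟩ := (hU.isConnected M _ (hmem j hj M hM le_rfl)).nonempty
      exact ⟨z, fun _ => hz⟩
    · exact ⟨x, fun h => absurd h hj⟩
  choose z hz using hex
  have hpw : ∀ m, (0 : ℝ) ≤ R * (1 / 2) ^ m := fun m => by positivity
  have hdist : ∀ j ≤ k, ∀ m, n ≤ m → m ≤ M → ∀ u ∈ σ j m, dist (z j) u ≤ 2 * R * (1 / 2) ^ m := by
    intro j hj m hn hm u hu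
    have := h.dist_le hU hA hj hn hm hu (hz j hj)
    have := hpw M
    linarith
  have hfine : ∀ j ≤ k, ∀ a ∈ σ j M, ∀ b ∈ σ j M, dist a b ≤ R * (1 / 2) ^ M := fun j hj a ha b hb =>
    hU.dist_le M _ (hmem j hj M hM le_rfl) a ha b hb
  refine ⟨[x] ++ ((List.range (k + 1)).map z ++ [y]), ?_, ?_, ?_⟩
  · refine (IsStepWalk.single x).append ?_ ((IsStepWalk.map_range fun j hj => ?_).append ?_
      (.single y))
    · have := hfine 0 (Nat.zero_le _) x h.left_mem _ (hz 0 (Nat.zero_le _))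
      have := hpw M
      linarith
    · obtain ⟨w, hw, hw'⟩ := h.link j hj
      have h1 := hfine j hj.le _ (hz j hj.le) w hw
      have h2 := hfine (j + 1) hj w hw' _ (hz (j + 1) hj)
      have := dist_triangle (z j) w (z (j + 1))
      linarith
    · have := hfine k le_rfl _ (hz k le_rfl) y h.right_mem
      have := hpw M
      linarith
  · have hAd : ∀ a ∈ A, ∀ u ∈ A, dist a u ≤ 2 * R * (1 / 2) ^ n := by
      intro a ha u hu
      have := hU.dist_le n A hA a ha u hu
      have := hpw n
      linarith
    intro a ha u hu
    simp only [List.mem_append, List.mem_singleton, List.mem_map, List.mem_range] at ha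
    rcases ha with rfl | ⟨j, hj, rfl⟩ | rfl
    · exact hAd _ hx u hu
    · exact hdist j (by omega) n le_rfl hM u (by rwa [h.base j (by omega)])
    · exact hAd _ hy u hu
  · intro m hnm hm
    have hr : (0 : ℝ) ≤ 4 * R * (1 / 2) ^ m := by positivity
    have h1 : ∀ w : X, HasPieces (4 * R * (1 / 2) ^ m) 1 [w] := fun w =>
      HasPieces.one (by simpa using hr)
    have h2 : HasPieces (4 * R * (1 / 2) ^ m) (U m).card ((List.range (k + 1)).map z) := by
      refine HasPieces.map_range (c := fun j => σ j m) (fun j hj => hmem j hj m hnm.le hm)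
        (h.block m hnm hm) fun i hi j hj heq => ?_
      obtain ⟨u, hu⟩ := (hU.isConnected m _ (hmem i hi m hnm.le hm)).nonempty
      have d1 := hdist i hi m hnm.le hm u hu
      have d2 := hdist j hj m hnm.le hm u (heq ▸ hu)
      have := dist_triangle_right (z i) (z j) u
      linarith
    have := (h1 x).append (h2.append (h1 y))
    rwa [show 1 + ((U m).card + 1) = (U m).card + 2 by omega] at this

/-! ### Tours of the tree of covers -/

/-- A tree structure on the covers of a tower: every `D ∈ U (n + 1)` gets a parent `par n D ∈ U n`
meeting `D`, and the point `p (n + 1) D` is taken in the intersection of the two. -/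
structure IsParentMap {X : Type*} (U : ℕ → Finset (Set X)) (par : ℕ → Set X → Set X)
    (p : ℕ → Set X → X) : Prop where
  par_mem : ∀ n, ∀ D ∈ U (n + 1), par n D ∈ U n
  mem_self : ∀ n, ∀ C ∈ U n, p n C ∈ C
  mem_par : ∀ n, ∀ D ∈ U (n + 1), p (n + 1) D ∈ par n D

theorem IsConnectedTower.exists_isParentMap {X : Type*} [MetricSpace X] [Nonempty X] {R : ℝ}
    {U : ℕ → Finset (Set X)} (hU : IsConnectedTower R U) : ∃ par p, IsParentMap U par p := by
  have hex : ∀ n D, ∃ B z, D ∈ U (n + 1) → B ∈ U n ∧ z ∈ D ∧ z ∈ B := by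
    intro n D
    by_cases hD : D ∈ U (n + 1)
    · obtain ⟨z, hz⟩ := (hU.isConnected _ D hD).nonempty
      obtain ⟨B, hB, hzB⟩ := hU.cover n z
      exact ⟨B, z, fun _ => ⟨hB, hz, hzB⟩⟩
    · exact ⟨D, Classical.arbitrary X, fun h => absurd h hD⟩
  choose par z h using hex
  refine ⟨par, fun n C => match n with
    | 0 => Classical.arbitrary X
    | n + 1 => z n C, fun n D hD => (h n D hD).1, ?_, fun n D hD => (h n D hD).2.2⟩
  rintro (_ | n) C hC
  · rw [hU.zero, Finset.mem_singleton] at hC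
    simp [hC]
  · exact (h n C hC).2.1

/-- The ancestor in `U n` of a member of `U (n + j)`. -/
def ancestor {X : Type*} (par : ℕ → Set X → Set X) : ℕ → ℕ → Set X → Set X
  | 0, _, D => D
  | j + 1, n, D => par n (ancestor par j (n + 1) D)

theorem IsParentMap.ancestor_mem {X : Type*} {U : ℕ → Finset (Set X)} {par : ℕ → Set X → Set X}
    {p : ℕ → Set X → X} (h : IsParentMap U par p) {j n : ℕ} {D : Set X} (hD : D ∈ U (n + j)) :
    ancestor par j n D ∈ U n := by
  induction j generalizing n with
  | zero => exact hD
  | succ j ih => exact h.par_mem n _ (ih (by rwa [show n + 1 + j = n + (j + 1) by omega]))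

open Classical in
/-- A bound for the number of pieces of scale `2⁻ᵐ` in a tour of the descendants of `C ∈ U n` that
goes down `j` levels: a single piece if `m ≤ n`; otherwise one for the starting point and, for each
child of `C`, those of the way there, of the tour of that child, and of the way back. -/
noncomputable def tourPieces {X : Type*} (U : ℕ → Finset (Set X)) (par : ℕ → Set X → Set X)
    (m : ℕ) : ℕ → ℕ → Set X → ℕ
  | 0, _, _ => 1
  | j + 1, n, C => if m ≤ n then 1 else 1 + ∑ D ∈ U (n + 1) with par n D = C,
      ((U m).card + 2 + (tourPieces U par m j (n + 1) D + ((U m).card + 2)))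

theorem tourPieces_of_le {X : Type*} {U : ℕ → Finset (Set X)} {par : ℕ → Set X → Set X}
    {m n : ℕ} (h : m ≤ n) (j : ℕ) (C : Set X) : tourPieces U par m j n C = 1 := by
  cases j <;> simp [tourPieces, h]

/-- Summed over all `C ∈ U n`, the tours have about as many pieces of scale `2⁻ᵐ` as there are
ways to be travelled, times the number `(U m).card + 2` of pieces of a single one. The second
summand on the left accounts for the ways between the levels `n - 1` and `n`. -/
theorem IsParentMap.sum_tourPieces_le {X : Type*} {U : ℕ → Finset (Set X)}
    {par : ℕ → Set X → Set X} {p : ℕ → Set X → X} (h : IsParentMap U par p) {m j n : ℕ}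
    (hn : n ≤ m) (hm : m ≤ n + j) :
    ∑ C ∈ U n, tourPieces U par m j n C + (2 * (U m).card + 4) * (U n).card ≤
      (2 * (U m).card + 5) * ∑ i ∈ Finset.Icc n m, (U i).card := by
  classical
  induction j generalizing n with
  | zero =>
    obtain rfl : n = m := by omega
    simp only [tourPieces_of_le le_rfl, Finset.sum_const, smul_eq_mul, Finset.Icc_self,
      Finset.sum_singleton]
    linarith
  | succ j ih =>
    rcases hn.eq_or_lt with rfl | hlt
    · simp only [tourPieces_of_le le_rfl, Finset.sum_const, smul_eq_mul, Finset.Icc_self,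
        Finset.sum_singleton]
      linarith
    have hrec := ih (n := n + 1) hlt (by omega)
    have hsum : ∑ C ∈ U n, tourPieces U par m (j + 1) n C = (U n).card +
        ∑ D ∈ U (n + 1), ((U m).card + 2 +
          (tourPieces U par m j (n + 1) D + ((U m).card + 2))) := by
      rw [← Finset.sum_fiberwise_of_maps_to (h.par_mem n)]
      simp [tourPieces, not_le.2 hlt, Finset.sum_add_distrib]
    have hIcc : ∑ i ∈ Finset.Icc n m, (U i).card =
        (U n).card + ∑ i ∈ Finset.Icc (n + 1) m, (U i).card := by
      rw [Finset.Icc_add_one_left_eq_Ioc, ← Finset.Ioc_insert_left hn, Finset.sum_insert (by simp)]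
    rw [hsum, hIcc]
    simp only [Finset.sum_add_distrib, Finset.sum_const, smul_eq_mul]
    linarith

/-- The tour of the descendants of `C` in `U M`: a closed walk with steps of scale `2⁻ᴹ` which starts
at `p n C`, walks to the points of the children of `C`, makes the tour of each of them, and walks
back. -/
theorem IsParentMap.exists_tour {X : Type*} [MetricSpace X] {R : ℝ} {U : ℕ → Finset (Set X)}
    (hU : IsConnectedTower R U) {par : ℕ → Set X → Set X} {p : ℕ → Set X → X}
    (h : IsParentMap U par p) {j n M : ℕ} (hM : n + j = M) {C : Set X} (hC : C ∈ U n) :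
    ∃ l, IsStepWalk (2 * R * (1 / 2) ^ M) (p n C) l (p n C) ∧
      (∀ a ∈ l, dist a (p n C) ≤ 2 * R * (1 / 2) ^ n) ∧
      (∀ m ≤ M, HasPieces (4 * R * (1 / 2) ^ m) (tourPieces U par m j n C) l) ∧
      ∀ E ∈ U M, ancestor par j n E = C → p M E ∈ l := by
  classical
  have : Nonempty X := ⟨p n C⟩
  have hR := hU.nonneg
  have hδ : ∀ m, (0 : ℝ) ≤ 2 * R * (1 / 2) ^ m := fun m => by positivity
  -- Up to the level of `C` the whole tour is a single piece.
  have hone : ∀ (c : X) (n m : ℕ) (l : List X), m ≤ n → (∀ a ∈ l, dist a c ≤ 2 * R * (1 / 2) ^ n) →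
      HasPieces (4 * R * (1 / 2) ^ m) 1 l := by
    intro c n m l hmn hl
    refine HasPieces.one fun a ha b hb => ?_
    have h1 := hl a ha
    have h2 := hl b hb
    have h3 := dist_triangle_right a b c
    have h4 : 2 * R * (1 / 2 : ℝ) ^ n ≤ 2 * R * (1 / 2) ^ m :=
      mul_le_mul_of_nonneg_left (pow_le_pow_of_le_one (by norm_num) (by norm_num) hmn)
        (by positivity)
    linarith
  induction j generalizing n C with
  | zero =>
    obtain rfl : n = M := hM
    refine ⟨[p n C], .single _, by simpa using hδ n, fun m hm => ?_, ?_⟩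
    · rw [tourPieces_of_le hm]
      exact hone (p n C) n m _ hm (by simpa using hδ n)
    · rintro E - rfl
      simp [ancestor]
  | succ j ih =>
    have hfam : ∀ s ⊆ (U (n + 1)).filter (fun D => par n D = C),
        ∃ l, IsStepWalk (2 * R * (1 / 2) ^ M) (p n C) l (p n C) ∧
          (∀ a ∈ l, dist a (p n C) ≤ 2 * R * (1 / 2) ^ n) ∧
          (∀ m, n < m → m ≤ M → HasPieces (4 * R * (1 / 2) ^ m) (1 + ∑ D ∈ s,
            ((U m).card + 2 + (tourPieces U par m j (n + 1) D + ((U m).card + 2)))) l) ∧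
          ∀ E ∈ U M, ancestor par j (n + 1) E ∈ s → p M E ∈ l := by
      intro s
      induction s using Finset.induction_on with
      | empty =>
        intro _
        exact ⟨[p n C], .single _, by simpa using hδ n,
          fun m hnm hm => HasPieces.one (by simpa using hR), by simp⟩
      | @insert D s hDs ihs =>
        intro hsub
        obtain ⟨l, hwalk, hnear, hpieces, hmem⟩ :=
          ihs fun E hE => hsub (Finset.mem_insert_of_mem hE)
        obtain ⟨hD, hparD⟩ := Finset.mem_filter.1 (hsub (Finset.mem_insert_self D s))
        have hpC : p n C ∈ C := h.mem_self n C hC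
        have hpD : p (n + 1) D ∈ C := hparD ▸ h.mem_par n D hD
        obtain ⟨l₁, hwalk₁, hnear₁, hpieces₁⟩ :=
          hU.exists_isStepWalk (by omega : n ≤ M) hC hpC hpD
        obtain ⟨l₂, hwalk₂, hnear₂, hpieces₂⟩ :=
          hU.exists_isStepWalk (by omega : n ≤ M) hC hpD hpC
        obtain ⟨lD, hwalkD, hnearD, hpiecesD, hmemD⟩ := ih (by omega) hD
        have hself : ∀ x : X, dist x x ≤ 2 * R * (1 / 2) ^ M := fun x => by simpa using hδ M
        refine ⟨l ++ (l₁ ++ (lD ++ l₂)), hwalk.append (hself _) (hwalk₁.append (hself _)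
          (hwalkD.append (hself _) hwalk₂)), ?_, ?_, ?_⟩
        · intro a ha
          simp only [List.mem_append] at ha
          rcases ha with ha | ha | ha | ha
          · exact hnear a ha
          · exact hnear₁ a ha _ hpC
          · have h1 := hnearD a ha
            have h2 := hU.dist_le n C hC _ hpD _ hpC
            have h3 := dist_triangle a (p (n + 1) D) (p n C)
            have h4 : ((1 : ℝ) / 2) ^ (n + 1) = (1 / 2) ^ n / 2 := by ring
            rw [h4] at h1
            linarith
          · exact hnear₂ a ha _ hpC
        · intro m hnm hm
          rw [Finset.sum_insert hDs, add_left_comm, add_comm]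
          exact (hpieces m hnm hm).append ((hpieces₁ m hnm hm).append
            ((hpiecesD m hm).append (hpieces₂ m hnm hm)))
        · intro E hE hanc
          simp only [List.mem_append]
          rcases Finset.mem_insert.1 hanc with hanc | hanc
          · exact Or.inr (Or.inr (Or.inl (hmemD E hE hanc)))
          · exact Or.inl (hmem E hE hanc)
    obtain ⟨l, hwalk, hnear, hpieces, hmem⟩ := hfam _ subset_rfl
    refine ⟨l, hwalk, hnear, fun m hm => ?_, fun E hE hanc => hmem E hE ?_⟩
    · rcases Nat.lt_or_ge n m with hlt | hge
      · simpa [tourPieces, not_le.2 hlt] using hpieces m hlt hm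
      · rw [tourPieces_of_le hge]
        exact hone _ n m l hge hnear
    · exact Finset.mem_filter.2
        ⟨h.ancestor_mem (by rwa [show n + 1 + j = M by omega]), hanc⟩

/-! ### Parametrizations of tours and their limits -/

/-- The tour of the whole tower down to the level `M`. -/
theorem IsConnectedTower.exists_tour {X : Type*} [MetricSpace X] [Nonempty X] {R : ℝ}
    {U : ℕ → Finset (Set X)} (hU : IsConnectedTower R U) (M : ℕ) :
    ∃ l : List X, l ≠ [] ∧
      (∀ i (hi : i + 1 < l.length), dist l[i] l[i + 1] ≤ 2 * R * (1 / 2) ^ M) ∧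
      (∀ m ≤ M, HasPieces (4 * R * (1 / 2) ^ m)
        ((2 * (U m).card + 5) * ∑ i ∈ Finset.range (m + 1), (U i).card) l) ∧
      ∀ z, ∃ a ∈ l, dist a z ≤ R * (1 / 2) ^ M := by
  obtain ⟨par, p, h⟩ := hU.exists_isParentMap
  have hroot : Set.univ ∈ U 0 := by simp [hU.zero]
  obtain ⟨l, hwalk, -, hpieces, hmem⟩ := h.exists_tour hU (zero_add M) hroot
  refine ⟨l, hwalk.ne_nil, hwalk.dist_getElem_le, fun m hm => (hpieces m hm).mono ?_, fun z => ?_⟩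
  · have := h.sum_tourPieces_le (m := m) (j := M) (n := 0) (Nat.zero_le _) (by omega)
    rw [hU.zero, Finset.sum_singleton, ← Nat.range_succ_eq_Icc_zero] at this
    omega
  · obtain ⟨E, hE, hz⟩ := hU.cover M z
    refine ⟨p M E, hmem E hE ?_, hU.dist_le M E hE _ (h.mem_self M E hE) z hz⟩
    have := h.ancestor_mem (j := M) (n := 0) (D := E) (by simpa using hE)
    simpa [hU.zero] using this

/-- A finite walk with few pieces at each scale is run through in the unit time: the passage from
one piece of the `m`-th scale to the next takes the time `w m`, so a time interval shorter
than `w m` stays within one piece, up to a single step. -/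
theorem exists_parametrization {X : Type*} [MetricSpace X] {l : List X} (hl : l ≠ []) {δ : ℝ}
    (hstep : ∀ i (hi : i + 1 < l.length), dist l[i] l[i + 1] ≤ δ) {M : ℕ} {r w : ℕ → ℝ}
    {K : ℕ → ℕ} (hpieces : ∀ m ≤ M, HasPieces (r m) (K m) l) (hδ : 0 ≤ δ) (hr : ∀ m, 0 ≤ r m)
    (hw : ∀ m, 0 < w m) (hsum : ∑ m ∈ Finset.range (M + 1), w m * K m ≤ 1) :
    ∃ f : ℝ → X, (∀ m ≤ M, ∀ s t, |s - t| < w m → dist (f s) (f t) ≤ r m + δ) ∧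
      ∀ a ∈ l, ∃ t ∈ Set.Icc (0 : ℝ) 1, dist (f t) a ≤ r M := by
  classical
  choose! lam hmono hlt hdist using hpieces
  have hlen : 0 < l.length := List.length_pos_iff.2 hl
  set τ : ℕ → ℝ := fun i => ∑ m ∈ Finset.range (M + 1), w m * lam m i with hτ
  have hle : ∀ m ∈ Finset.range (M + 1), m ≤ M := fun m hm => by
    simpa [Nat.lt_succ_iff] using hm
  have hτmono : Monotone τ := fun i j hij => Finset.sum_le_sum fun m hm =>
    mul_le_mul_of_nonneg_left (Nat.cast_le.2 (hmono m (hle m hm) hij)) (hw m).le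
  have hτ0 : ∀ i, 0 ≤ τ i := fun i => Finset.sum_nonneg fun m _ =>
    mul_nonneg (hw m).le (Nat.cast_nonneg _)
  have hτ1 : ∀ i < l.length, τ i ≤ 1 := fun i hi =>
    (Finset.sum_le_sum fun m hm => mul_le_mul_of_nonneg_left
      (Nat.cast_le.2 (hlt m (hle m hm) i hi).le) (hw m).le).trans hsum
  have hclose : ∀ m ≤ M, ∀ i j (hij : i ≤ j) (hj : j < l.length), τ j - τ i < w m →
      dist l[i] l[j] ≤ r m := by
    intro m hm i j hij hj hlt'
    refine hdist m hm i j _ hj (le_antisymm (hmono m hm hij) ?_)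
    by_contra! hcon
    have h1 : (lam m i : ℝ) + 1 ≤ lam m j := by exact_mod_cast hcon
    have h2 : w m * lam m j - w m * lam m i ≤ τ j - τ i := by
      rw [hτ, ← Finset.sum_sub_distrib]
      refine Finset.single_le_sum (f := fun m => w m * (lam m j : ℝ) - w m * lam m i)
        (fun m' hm' => ?_) (Finset.mem_range.2 (by omega))
      have : (lam m' i : ℝ) ≤ lam m' j := Nat.cast_le.2 (hmono m' (hle m' hm') hij)
      have := mul_le_mul_of_nonneg_left this (hw m').le
      simpa using this
    nlinarith [hw m]
  -- At the time `t` the walk is at the last entry whose time is not after `t`.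
  set I : ℝ → ℕ := fun t => Nat.findGreatest (fun i => τ i ≤ t) (l.length - 1) with hI
  have hIlt : ∀ t, I t < l.length := fun t => by
    have : I t ≤ l.length - 1 := Nat.findGreatest_le _
    omega
  have hordered : ∀ m ≤ M, ∀ s t, s ≤ t → |s - t| < w m →
      dist (l[I s]'(hIlt s)) (l[I t]'(hIlt t)) ≤ r m + δ := by
    intro m hm s t hst habs
    have hIle : I s ≤ I t :=
      Nat.findGreatest_mono (fun i (hi : τ i ≤ s) => hi.trans hst) le_rfl
    rcases hIle.eq_or_lt with heq | hlt'
    · simp only [heq, dist_self]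
      exact add_nonneg (hr m) hδ
    have ht : τ (I t) ≤ t :=
      Nat.findGreatest_of_ne_zero (P := fun i => τ i ≤ t) (n := l.length - 1) rfl (by omega)
    have hs : s < τ (I s + 1) := by
      have := Nat.findGreatest_is_greatest (P := fun i => τ i ≤ s) (n := l.length - 1)
        (k := I s + 1) (Nat.lt_succ_self _) (by have := hIlt t; omega)
      simpa using this
    have hI1 : I s + 1 < l.length := by have := hIlt t; omega
    rw [abs_sub_comm, abs_of_nonneg (by linarith)] at habs
    have h1 := hstep (I s) hI1
    have h2 := hclose m hm (I s + 1) (I t) hlt' (hIlt t) (by linarith)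
    have h3 := dist_triangle (l[I s]'(hIlt s)) (l[I s + 1]) (l[I t]'(hIlt t))
    linarith
  refine ⟨fun t => l[I t]'(hIlt t), fun m hm s t h => ?_, fun a ha => ?_⟩
  · rcases le_total s t with hst | hst
    · exact hordered m hm s t hst h
    · rw [dist_comm]
      exact hordered m hm t s hst (by rwa [abs_sub_comm])
  · obtain ⟨i, hi, rfl⟩ := List.getElem_of_mem ha
    refine ⟨τ i, ⟨hτ0 i, hτ1 i hi⟩, ?_⟩
    have hile : i ≤ I (τ i) := Nat.le_findGreatest (by omega) le_rfl
    have hτI : τ (I (τ i)) ≤ τ i := by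
      rcases Nat.eq_zero_or_pos (I (τ i)) with h0 | h0
      · exact hτmono (by omega)
      · exact Nat.findGreatest_of_ne_zero (P := fun k => τ k ≤ τ i) (n := l.length - 1) rfl
          (by omega)
    rw [dist_comm]
    exact hclose M le_rfl i _ hile (hIlt _) (by have := hw M; linarith)

/-- A pointwise limit along an ultrafilter of approximately surjective maps that share an
approximate modulus of continuity. -/
theorem exists_surjective_limit {X : Type*} [MetricSpace X] [CompactSpace X]
    {f : ℕ → unitInterval → X} {w r e : ℕ → ℝ} (hw : ∀ m, 0 < w m)
    (hr : Tendsto r atTop (𝓝 0)) (he : Tendsto e atTop (𝓝 0))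
    (hf : ∀ m M, m ≤ M → ∀ s t : unitInterval, |(s : ℝ) - t| < w m → dist (f M s) (f M t) ≤ r m)
    (hdense : ∀ M z, ∃ t, dist (f M t) z ≤ e M) :
    ∃ g : unitInterval → X, Function.Surjective g ∧
      ∀ m (s t : unitInterval), |(s : ℝ) - t| < w m → dist (g s) (g t) ≤ r m := by
  set 𝒰 : Ultrafilter ℕ := Filter.hyperfilter ℕ with h𝒰
  have hle : (𝒰 : Filter ℕ) ≤ atTop := Nat.hyperfilter_le_atTop
  set g : unitInterval → X := fun t => (𝒰.map fun M => f M t).lim with hgdef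
  have hg : ∀ t, Tendsto (fun M => f M t) 𝒰 (𝓝 (g t)) := fun t =>
    (𝒰.map fun M => f M t).le_nhds_lim
  refine ⟨g, fun z => ?_, fun m s t h => ?_⟩
  · choose t ht using fun M => hdense M z
    obtain ⟨t₀, ht₀⟩ : ∃ t₀, Tendsto t 𝒰 (𝓝 t₀) := ⟨_, (𝒰.map t).le_nhds_lim⟩
    refine ⟨t₀, dist_le_zero.1 ?_⟩
    refine ge_of_tendsto hr (Eventually.of_forall fun m => ?_)
    have h1 : Tendsto (fun M => dist (f M t₀) z) 𝒰 (𝓝 (dist (g t₀) z)) :=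
      (hg t₀).dist tendsto_const_nhds
    have h2 : Tendsto (fun M => r m + e M) 𝒰 (𝓝 (r m + 0)) :=
      tendsto_const_nhds.add (he.mono_left hle)
    rw [add_zero] at h2
    refine le_of_tendsto_of_tendsto h1 h2 ?_
    have h3 : ∀ᶠ M in (𝒰 : Filter ℕ), dist (t M) t₀ < w m :=
      ht₀.eventually (Metric.ball_mem_nhds t₀ (hw m))
    filter_upwards [h3, hle (eventually_ge_atTop m)] with M hM hmM
    have h4 : |(t₀ : ℝ) - t M| < w m := by
      rw [abs_sub_comm]
      exact hM
    exact (dist_triangle _ (f M (t M)) _).trans (add_le_add (hf m M hmM _ _ h4) (ht M))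
  · refine le_of_tendsto ((hg s).dist (hg t)) ?_
    filter_upwards [hle (eventually_ge_atTop m)] with M hM
    exact hf m M hM s t h

/-- If the sizes of the covers of a tower grow slowly enough, then `X` is the image of a map of
the unit interval which has `θᵐ ↦ 2⁻ᵐ` as a modulus of continuity, up to constants. -/
theorem IsConnectedTower.exists_surjective {X : Type*} [MetricSpace X] [CompactSpace X]
    [Nonempty X] {R : ℝ} {U : ℕ → Finset (Set X)} (hU : IsConnectedTower R U) {θ : ℝ}
    (hθ : 0 < θ) {K : ℕ → ℕ}
    (hK : ∀ m, (2 * (U m).card + 5) * ∑ i ∈ Finset.range (m + 1), (U i).card = K m)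
    (hsum : Summable fun m => θ ^ m * (K m : ℝ)) :
    ∃ c > 0, ∃ g : unitInterval → X, Function.Surjective g ∧
      ∀ m (s t : unitInterval), |(s : ℝ) - t| < c * θ ^ m →
        dist (g s) (g t) ≤ 6 * R * (1 / 2) ^ m := by
  have hR := hU.nonneg
  obtain ⟨T, hT0, hT⟩ : ∃ T : ℝ, 0 ≤ T ∧
      ∀ M, ∑ m ∈ Finset.range (M + 1), θ ^ m * (K m : ℝ) ≤ T :=
    ⟨∑' m, θ ^ m * (K m : ℝ), tsum_nonneg fun m => by positivity, fun M =>
      hsum.sum_le_tsum _ fun m _ => by positivity⟩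
  have hpow : Tendsto (fun m : ℕ => ((1 : ℝ) / 2) ^ m) atTop (𝓝 0) :=
    tendsto_pow_atTop_nhds_zero_of_lt_one (by norm_num) (by norm_num)
  have hmain : ∀ M, ∃ f : unitInterval → X, (∀ m ≤ M, ∀ s t : unitInterval,
      |(s : ℝ) - t| < (T + 1)⁻¹ * θ ^ m → dist (f s) (f t) ≤ 6 * R * (1 / 2) ^ m) ∧
      ∀ z, ∃ t, dist (f t) z ≤ 5 * R * (1 / 2) ^ M := by
    intro M
    obtain ⟨l, hl, hstep, hpieces, hdense⟩ := hU.exists_tour M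
    simp only [hK] at hpieces
    obtain ⟨f, hf, hfd⟩ := exists_parametrization hl hstep (w := fun m => (T + 1)⁻¹ * θ ^ m)
      hpieces (by positivity) (fun m => by positivity) (fun m => by positivity) (by
        simp only [mul_assoc, ← Finset.mul_sum]
        have h1 := hT M
        calc (T + 1)⁻¹ * ∑ m ∈ Finset.range (M + 1), θ ^ m * (K m : ℝ) ≤ (T + 1)⁻¹ * (T + 1) :=
              mul_le_mul_of_nonneg_left (by linarith) (by positivity)
          _ = 1 := inv_mul_cancel₀ (by positivity))
    refine ⟨fun t => f t, fun m hm s t hst => ?_, fun z => ?_⟩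
    · have h1 := hf m hm s t hst
      have h2 : 2 * R * (1 / 2 : ℝ) ^ M ≤ 2 * R * (1 / 2) ^ m :=
        mul_le_mul_of_nonneg_left (pow_le_pow_of_le_one (by norm_num) (by norm_num) hm)
          (by positivity)
      linarith
    · obtain ⟨a, ha, haz⟩ := hdense z
      obtain ⟨t, ht, hta⟩ := hfd a ha
      refine ⟨⟨t, ht⟩, ?_⟩
      have := dist_triangle (f t) a z
      dsimp only
      linarith
  choose f hf hfd using hmain
  refine ⟨(T + 1)⁻¹, by positivity, exists_surjective_limit (fun m => by positivity) ?_ ?_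
    (fun m M hm => hf M m hm) hfd⟩
  · simpa using hpow.const_mul (6 * R)
  · simpa using hpow.const_mul (5 * R)

/-! ### The Sierpiński function and Hölder maps -/

theorem sierpinskiFunction_le {X : Type*} [MetricSpace X] {ε : ℝ} {𝒞 : Set (Set X)}
    (h : IsConnectedCover ε 𝒞) : sierpinskiFunction X ε ≤ 𝒞.encard :=
  sInf_le ⟨𝒞, h, rfl⟩

theorem exists_isConnectedCover {X : Type*} [MetricSpace X] {ε : ℝ}
    (h : sierpinskiFunction X ε ≠ ⊤) :
    ∃ 𝒞 : Set (Set X), IsConnectedCover ε 𝒞 ∧ 𝒞.encard = sierpinskiFunction X ε := by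
  refine csInf_mem (s := {n : ℕ∞ | ∃ 𝒞 : Set (Set X), IsConnectedCover ε 𝒞 ∧ 𝒞.encard = n}) ?_
  by_contra hne
  refine h ?_
  rw [sierpinskiFunction, Set.not_nonempty_iff_eq_empty.1 hne, sInf_empty]

theorem log_div_log_le_iff {S : ℝ≥0∞} {ε : ℝ} (h0 : 0 < ε) (h1 : ε < 1) (a : ℝ) :
    ENNReal.log S / ((Real.log (1 / ε) : ℝ) : EReal) ≤ a ↔ S ≤ ENNReal.ofReal ((1 / ε) ^ a) := by
  have hlog : 0 < Real.log (1 / ε) := Real.log_pos (by rw [lt_div_iff₀ h0]; linarith)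
  rw [EReal.div_le_iff_le_mul (by exact_mod_cast hlog) (EReal.coe_ne_top _), ← EReal.coe_mul,
    mul_comm, ← Real.log_rpow (by positivity), ← ENNReal.log_ofReal_of_pos (by positivity),
    ENNReal.log_le_log_iff]

/-- Cutting the unit interval into `n` equal parts covers the image of a Hölder map. -/
theorem HolderWith.sierpinskiFunction_le {X : Type*} [MetricSpace X] {f : unitInterval → X}
    (hf : Function.Surjective f) {C r : ℝ≥0} (h : HolderWith C r f) (hr : 0 < r) {ε : ℝ} {n : ℕ}
    (hn : 0 < n) (hε : C * (1 / n : ℝ) ^ (r : ℝ) ≤ ε) : sierpinskiFunction X ε ≤ n := by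
  classical
  have hn' : (0 : ℝ) < n := Nat.cast_pos.2 hn
  set F : ℝ → X := fun t => f (Set.projIcc 0 1 zero_le_one t) with hF
  have hFc : Continuous F := (h.continuous hr).comp continuous_projIcc
  set A : ℕ → Set X := fun i => F '' Set.Icc (i / n : ℝ) ((i + 1) / n) with hA
  have hcover : IsConnectedCover ε ((Finset.range n).image A : Set (Set X)) := by
    refine ⟨Set.eq_univ_of_forall fun z => ?_, ?_⟩
    · obtain ⟨t, rfl⟩ := hf z
      -- The end point `1` belongs to the last part.
      obtain ⟨i, hi, hi1, hi2⟩ : ∃ i < n, (i : ℝ) ≤ (t : ℝ) * n ∧ (t : ℝ) * n ≤ i + 1 := by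
        have ht0 : (0 : ℝ) ≤ (t : ℝ) * n := mul_nonneg t.2.1 hn'.le
        rcases Nat.lt_or_ge ⌊(t : ℝ) * n⌋₊ n with hlt | hge
        · exact ⟨_, hlt, Nat.floor_le ht0, (Nat.lt_floor_add_one _).le⟩
        · have h1 : (n : ℝ) ≤ (t : ℝ) * n := (Nat.cast_le.2 hge).trans (Nat.floor_le ht0)
          have h2 : (t : ℝ) * n ≤ n := mul_le_of_le_one_left hn'.le t.2.2
          refine ⟨n - 1, by omega, ?_, ?_⟩ <;> rw [Nat.cast_sub hn] <;> push_cast <;> linarith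
      refine ⟨A i, by simpa using ⟨i, hi, rfl⟩, t, ⟨?_, ?_⟩, ?_⟩
      · rwa [div_le_iff₀ hn']
      · rwa [le_div_iff₀ hn']
      · simp [hF]
    · intro B hB
      obtain ⟨i, -, rfl⟩ := Finset.mem_image.1 (Finset.mem_coe.1 hB)
      refine ⟨(isConnected_Icc (by gcongr; linarith)).image F hFc.continuousOn,
        Metric.ediam_le ?_⟩
      rintro _ ⟨s, hs, rfl⟩ _ ⟨t, ht, rfl⟩
      refine (h.edist_le _ _).trans (le_trans ?_ (ENNReal.ofReal_le_ofReal hε))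
      rw [ENNReal.ofReal_mul C.coe_nonneg, ENNReal.ofReal_coe_nnreal,
        ← ENNReal.ofReal_rpow_of_nonneg (by positivity) r.coe_nonneg, edist_dist]
      gcongr
      refine (Set.abs_projIcc_sub_projIcc zero_le_one).trans ?_
      have : ((i : ℝ) + 1) / n = i / n + 1 / n := add_div _ _ _
      rw [abs_le]
      constructor <;> linarith [hs.1, hs.2, ht.1, ht.2]
  refine (_root_.sierpinskiFunction_le hcover).trans ?_
  rw [Set.encard_coe_eq_coe_finsetCard]
  exact_mod_cast Finset.card_image_le.trans (Finset.card_range n).le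

theorem sDim_le_of_holderWith {X : Type*} [MetricSpace X] {f : unitInterval → X}
    (hf : Function.Surjective f) {C r : ℝ≥0} {a : ℝ} (ha : 0 < a) (hr : (r : ℝ) = a⁻¹)
    (h : HolderWith C r f) : sDim X ≤ (a : EReal) := by
  have hr0 : 0 < r := by
    have : (0 : ℝ) < r := by rw [hr]; positivity
    exact_mod_cast this
  refine EReal.le_of_forall_lt_iff_le.1 fun z hz => ?_
  have haz : a < z := by exact_mod_cast hz
  refine limsup_le_of_le (by isBoundedDefault) ?_
  have hinv : Tendsto (fun ε : ℝ => 1 / ε) (𝓝[>] 0) atTop := by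
    simpa using tendsto_inv_nhdsGT_zero (𝕜 := ℝ)
  have hlarge := ((tendsto_rpow_atTop (sub_pos.2 haz)).comp hinv).eventually_ge_atTop
    ((C : ℝ) ^ a + 2)
  filter_upwards [hlarge, self_mem_nhdsWithin,
    nhdsWithin_le_nhds (gt_mem_nhds (zero_lt_one (α := ℝ)))] with ε hε h0 h1
  have h0' : (0 : ℝ) < ε := h0
  simp only [Function.comp_apply] at hε
  rw [log_div_log_le_iff h0' h1]
  set u : ℝ := 1 / ε with hu
  have hu0 : 0 < u := by positivity
  have hu1 : 1 ≤ u := by rw [hu, le_div_iff₀ h0']; linarith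
  have hCu : (0 : ℝ) ≤ (C * u) ^ a := by positivity
  set n : ℕ := ⌈(C * u) ^ a⌉₊ + 1 with hn
  have hnlow : (C * u) ^ a ≤ n := by
    rw [hn]; push_cast
    linarith [Nat.le_ceil ((C * u) ^ a)]
  have hn0 : (0 : ℝ) < n := by rw [hn]; positivity
  have hS : sierpinskiFunction X ε ≤ n := by
    refine h.sierpinskiFunction_le hf hr0 (by omega) ?_
    have h2 : C * u ≤ (n : ℝ) ^ a⁻¹ := by
      have := Real.rpow_le_rpow hCu hnlow r.coe_nonneg
      rwa [hr, Real.rpow_rpow_inv (by positivity) ha.ne'] at this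
    rw [hr, Real.div_rpow zero_le_one hn0.le, Real.one_rpow, mul_one_div,
      div_le_iff₀ (by positivity)]
    have : C * u * ε = C := by rw [hu]; field_simp
    nlinarith
  have hnup : (n : ℝ) ≤ u ^ z := by
    have h3 : (n : ℝ) ≤ (C * u) ^ a + 2 := by
      rw [hn]; push_cast
      linarith [Nat.ceil_lt_add_one hCu]
    have h4 : (1 : ℝ) ≤ u ^ a := Real.one_le_rpow hu1 ha.le
    have h5 : u ^ z = u ^ (z - a) * u ^ a := by
      rw [← Real.rpow_add hu0]; congr 1; ring
    rw [Real.mul_rpow C.coe_nonneg hu0.le] at h3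
    rw [h5]
    nlinarith [mul_le_mul_of_nonneg_right hε (by positivity : (0 : ℝ) ≤ u ^ a)]
  calc (sierpinskiFunction X ε : ℝ≥0∞) ≤ ((n : ℕ∞) : ℝ≥0∞) := by exact_mod_cast hS
    _ = ENNReal.ofReal n := by simp
    _ ≤ ENNReal.ofReal (u ^ z) := ENNReal.ofReal_le_ofReal hnup

theorem sDim_le_holderDim (X : Type*) [MetricSpace X] : sDim X ≤ (holderDim X : EReal) := by
  have h : (sDim X).toENNReal ≤ holderDim X := by
    refine le_sInf ?_
    rintro α ⟨hα, f, hf, C, hC⟩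
    rcases eq_or_ne α ⊤ with rfl | htop
    · exact le_top
    rw [← EReal.toENNReal_coe (x := α)]
    refine EReal.toENNReal_le_toENNReal ?_
    rw [← EReal.coe_ennreal_toReal htop]
    refine sDim_le_of_holderWith hf (ENNReal.toReal_pos hα.ne' htop) ?_ hC
    change (1 / α).toReal = _
    simp
  have h' : sDim X ≤ ((sDim X).toENNReal : EReal) := by
    rw [EReal.coe_toENNReal_eq_max]
    exact le_max_right _ _
  exact h'.trans (EReal.coe_ennreal_le_coe_ennreal_iff.2 h)

/-- Passing to closures changes neither connectedness nor diameters. -/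
theorem exists_closed_cover {X : Type*} [MetricSpace X] {ε N : ℝ} (hε : 0 ≤ ε) (hN : 0 ≤ N)
    (h : (sierpinskiFunction X ε : ℝ≥0∞) ≤ ENNReal.ofReal N) :
    ∃ V : Finset (Set X), (∀ B ∈ V, IsClosed B) ∧ (∀ B ∈ V, IsConnected B) ∧
      (∀ z, ∃ B ∈ V, z ∈ B) ∧ (∀ B ∈ V, ∀ x ∈ B, ∀ y ∈ B, dist x y ≤ ε) ∧ (V.card : ℝ) ≤ N := by
  classical
  have htop : sierpinskiFunction X ε ≠ ⊤ := by
    intro h'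
    rw [h'] at h
    simp at h
  obtain ⟨𝒞, ⟨hcov, h𝒞⟩, hcard⟩ := exists_isConnectedCover htop
  have hfin : 𝒞.Finite := Set.encard_ne_top_iff.1 (hcard ▸ htop)
  refine ⟨hfin.toFinset.image closure, ?_, ?_, ?_, ?_, ?_⟩
  · intro B hB
    obtain ⟨A, -, rfl⟩ := Finset.mem_image.1 hB
    exact isClosed_closure
  · intro B hB
    obtain ⟨A, hA, rfl⟩ := Finset.mem_image.1 hB
    exact (h𝒞 A (hfin.mem_toFinset.1 hA)).1.closure
  · intro z
    obtain ⟨A, hA, hz⟩ : z ∈ ⋃₀ 𝒞 := hcov ▸ Set.mem_univ z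
    exact ⟨closure A, Finset.mem_image_of_mem _ (hfin.mem_toFinset.2 hA), subset_closure hz⟩
  · intro B hB x hx y hy
    obtain ⟨A, hA, rfl⟩ := Finset.mem_image.1 hB
    have h1 := Metric.edist_le_ediam_of_mem hx hy
    rw [Metric.ediam_closure, edist_dist] at h1
    exact (ENNReal.ofReal_le_ofReal_iff hε).1 (h1.trans (h𝒞 A (hfin.mem_toFinset.1 hA)).2)
  · have h1 : (hfin.toFinset.card : ℝ) ≤ N := by
      rw [← hcard, ← Set.Finite.coe_toFinset hfin, Set.encard_coe_eq_coe_finsetCard] at h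
      simp only [ENat.toENNReal_coe] at h
      rw [← ENNReal.ofReal_natCast] at h
      simpa using (ENNReal.ofReal_le_ofReal_iff hN).1 h
    exact (Nat.cast_le.2 Finset.card_image_le).trans h1

/-- A Sierpiński function that is at most `ε⁻ᵃ` for small `ε` yields a tower. The `n`-th cover is taken
at the scale `2⁻⁽ⁿ⁺ⁿ⁰⁾`, where the bound is valid for all scales from `2⁻ⁿ⁰` on; this costs a constant
factor in the size of the covers. The cover for `n = 0` is replaced by `{X}`, which costs a constant
factor in the diameters. -/
theorem exists_isConnectedTower {X : Type*} [MetricSpace X] [CompactSpace X] [ConnectedSpace X]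
    {a : ℝ} (h : ∀ᶠ ε : ℝ in 𝓝[>] 0,
      (sierpinskiFunction X ε : ℝ≥0∞) ≤ ENNReal.ofReal ((1 / ε) ^ a)) :
    ∃ R U, IsConnectedTower (X := X) R U ∧ ∃ B : ℝ, 1 ≤ B ∧
      ∀ n, ((U n).card : ℝ) ≤ B * ((2 : ℝ) ^ a) ^ n := by
  have hpow : Tendsto (fun n : ℕ => ((1 : ℝ) / 2) ^ n) atTop (𝓝[>] 0) :=
    tendsto_nhdsWithin_iff.2 ⟨tendsto_pow_atTop_nhds_zero_of_lt_one (by norm_num) (by norm_num),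
      Eventually.of_forall fun n => Set.mem_Ioi.2 (by positivity)⟩
  obtain ⟨n₀, hn₀⟩ := eventually_atTop.1 (hpow.eventually h)
  have hV := fun n => exists_closed_cover (X := X) (by positivity) (by positivity)
    (hn₀ (n + n₀) (by omega))
  choose V hV1 hV2 hV3 hV4 hV5 using hV
  have hpn : ∀ n : ℕ, (1 / (1 / 2 : ℝ) ^ n) ^ a = ((2 : ℝ) ^ a) ^ n := by
    intro n
    rw [Real.rpow_pow_comm zero_le_two, one_div, ← inv_pow, one_div, inv_inv]
  simp only [hpn] at hV5
  set R : ℝ := max 1 (Metric.diam (Set.univ : Set X)) with hR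
  refine ⟨R, fun n => if n = 0 then {Set.univ} else V n, ⟨by simp, ?_, ?_, ?_, ?_⟩,
    max 1 (((2 : ℝ) ^ a) ^ n₀), le_max_left _ _, ?_⟩
  · intro n B
    split_ifs
    · rintro hB
      rw [Finset.mem_singleton.1 hB]
      exact isClosed_univ
    · exact hV1 n B
  · intro n B
    split_ifs
    · rintro hB
      rw [Finset.mem_singleton.1 hB]
      exact isConnected_univ
    · exact hV2 n B
  · intro n z
    split_ifs
    · exact ⟨Set.univ, by simp, trivial⟩
    · exact hV3 n z
  · intro n B
    split_ifs with hn
    · intro _ x _ y _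
      rw [hn, pow_zero, mul_one]
      exact (Metric.dist_le_diam_of_mem isCompact_univ.isBounded (Set.mem_univ x)
        (Set.mem_univ y)).trans (le_max_right _ _)
    · intro hB x hx y hy
      refine (hV4 n B hB x hx y hy).trans ?_
      calc (1 / 2 : ℝ) ^ (n + n₀) ≤ (1 / 2) ^ n :=
            pow_le_pow_of_le_one (by norm_num) (by norm_num) (by omega)
        _ ≤ R * (1 / 2) ^ n := le_mul_of_one_le_left (by positivity) (le_max_left _ _)
  · intro n
    dsimp only
    split_ifs with hn
    · simp [hn]
    · refine (hV5 n).trans ?_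
      rw [pow_add, mul_comm]
      gcongr
      exact le_max_right _ _

/-- With covers of size about `bⁿ` the number of pieces of the tours at scale `2⁻ᵐ` is at most about
`m * b²ᵐ`. -/
theorem summable_mul_of_card_le {X : Type*} {U : ℕ → Finset (Set X)} {B b θ : ℝ} (hB : 1 ≤ B)
    (hb : 1 ≤ b) (hθ : 0 < θ) (hbθ : θ * b ^ 2 < 1) (hU : ∀ n, ((U n).card : ℝ) ≤ B * b ^ n)
    {K : ℕ → ℕ}
    (hK : ∀ m, (2 * (U m).card + 5) * ∑ i ∈ Finset.range (m + 1), (U i).card = K m) :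
    Summable fun m => θ ^ m * (K m : ℝ) := by
  have hq0 : 0 ≤ θ * b ^ 2 := by positivity
  have hq : ‖θ * b ^ 2‖ < 1 := by rwa [Real.norm_of_nonneg hq0]
  have hs : Summable fun m : ℕ => 7 * B ^ 2 * ((m : ℝ) ^ 1 * (θ * b ^ 2) ^ m + (θ * b ^ 2) ^ m) :=
    ((summable_pow_mul_geometric_of_norm_lt_one 1 hq).add
      (summable_geometric_of_norm_lt_one hq)).mul_left _
  refine Summable.of_nonneg_of_le (fun m => by positivity) (fun m => ?_) hs
  have hbm : 1 ≤ b ^ m := one_le_pow₀ hb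
  have hBb : 1 ≤ B * b ^ m := one_le_mul_of_one_le_of_one_le hB hbm
  have h1 : ∑ i ∈ Finset.range (m + 1), ((U i).card : ℝ) ≤ (m + 1) * (B * b ^ m) := by
    refine (Finset.sum_le_card_nsmul _ _ (B * b ^ m) fun i hi => (hU i).trans ?_).trans ?_
    · have : i ≤ m := by simpa [Nat.lt_succ_iff] using hi
      gcongr
    · simp
  have h2 : (2 * ((U m).card : ℝ) + 5) ≤ 7 * (B * b ^ m) := by linarith [hU m]
  have h3 : (K m : ℝ) ≤ 7 * (B * b ^ m) * ((m + 1) * (B * b ^ m)) := by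
    rw [← hK m]
    push_cast
    exact mul_le_mul h2 h1 (by positivity) (by positivity)
  calc θ ^ m * (K m : ℝ) ≤ θ ^ m * (7 * (B * b ^ m) * ((m + 1) * (B * b ^ m))) :=
        mul_le_mul_of_nonneg_left h3 (by positivity)
    _ = _ := by rw [mul_pow, ← pow_mul, mul_comm 2 m, pow_mul]; ring

/-- A map of the unit interval with `θᵐ ↦ 2⁻ᵐ`, `θ = 2⁻ᵅ`, as a modulus of continuity is
`1 / α`-Hölder. -/
theorem holderWith_of_modulus {X : Type*} [MetricSpace X] {g : unitInterval → X} {α c D : ℝ}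
    (hα : 0 < α) (hc : 0 < c) (hD : 0 ≤ D) (hbdd : ∀ s t, dist (g s) (g t) ≤ D)
    (hg : ∀ m (s t : unitInterval), |(s : ℝ) - t| < c * ((1 / 2 : ℝ) ^ α) ^ m →
        dist (g s) (g t) ≤ D * (1 / 2) ^ m) {r : ℝ≥0} (hr : (r : ℝ) = α⁻¹) :
    ∃ C : ℝ≥0, HolderWith C r g := by
  classical
  have hE : 0 ≤ 2 * D * (1 / c) ^ α⁻¹ := by positivity
  refine ⟨(2 * D * (1 / c) ^ α⁻¹).toNNReal, fun s t => ?_⟩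
  suffices h : dist (g s) (g t) ≤ 2 * D * (1 / c) ^ α⁻¹ * |(s : ℝ) - t| ^ α⁻¹ by
    rw [edist_dist, edist_dist, hr, ENNReal.ofReal_rpow_of_nonneg dist_nonneg (by positivity),
      ← ENNReal.ofReal, ← ENNReal.ofReal_mul hE]
    exact ENNReal.ofReal_le_ofReal h
  rcases eq_or_ne s t with rfl | hst
  · simpa using by positivity
  set x : ℝ := |(s : ℝ) - t| with hx
  have hx0 : 0 < x := abs_pos.2 (sub_ne_zero.2 fun h => hst (Subtype.ext h))
  set θ : ℝ := (1 / 2 : ℝ) ^ α with hθ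
  have hθ0 : 0 < θ := by positivity
  have hθ1 : θ < 1 := Real.rpow_lt_one (by norm_num) (by norm_num) hα
  have hex : ∃ m, c * θ ^ m ≤ x := by
    have : Tendsto (fun m : ℕ => c * θ ^ m) atTop (𝓝 0) := by
      simpa using (tendsto_pow_atTop_nhds_zero_of_lt_one hθ0.le hθ1).const_mul c
    exact (this.eventually_le_const hx0).exists
  -- The first scale which is finer than the distance of `s` and `t`.
  obtain ⟨m, hm, hmin⟩ : ∃ m, c * θ ^ m ≤ x ∧ ∀ k < m, x < c * θ ^ k :=
    ⟨Nat.find hex, Nat.find_spec hex, fun k hk => not_le.1 (Nat.find_min hex hk)⟩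
  have hpow : (1 / 2 : ℝ) ^ m ≤ (1 / c) ^ α⁻¹ * x ^ α⁻¹ := by
    have h1 : θ ^ m ≤ 1 / c * x := by
      rw [one_div, ← div_eq_inv_mul, le_div_iff₀ hc]
      linarith
    have h2 : ((1 / 2 : ℝ) ^ m) = (θ ^ m) ^ α⁻¹ := by
      rw [hθ, Real.rpow_pow_comm (by norm_num), Real.rpow_rpow_inv (by positivity) hα.ne']
    rw [h2, ← Real.mul_rpow (by positivity) hx0.le]
    exact Real.rpow_le_rpow (by positivity) h1 (by positivity)
  have hdist : dist (g s) (g t) ≤ 2 * D * (1 / 2) ^ m := by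
    rcases m with _ | k
    · linarith [hbdd s t]
    · refine (hg k s t (hmin k (Nat.lt_succ_self k))).trans (le_of_eq ?_)
      ring
  calc dist (g s) (g t) ≤ 2 * D * (1 / 2) ^ m := hdist
    _ ≤ 2 * D * ((1 / c) ^ α⁻¹ * x ^ α⁻¹) := mul_le_mul_of_nonneg_left hpow (by positivity)
    _ = _ := by ring

theorem exists_surjective_holderWith {X : Type*} [MetricSpace X] [CompactSpace X]
    [ConnectedSpace X] {a α : ℝ} (ha : 0 < a) (hα : 2 * a < α)
    (h : ∀ᶠ ε : ℝ in 𝓝[>] 0,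
      (sierpinskiFunction X ε : ℝ≥0∞) ≤ ENNReal.ofReal ((1 / ε) ^ a))
    {r : ℝ≥0} (hr : (r : ℝ) = α⁻¹) :
    ∃ g : unitInterval → X, Function.Surjective g ∧ ∃ C : ℝ≥0, HolderWith C r g := by
  obtain ⟨R, U, hU, B, hB, hcard⟩ := exists_isConnectedTower h
  have hR := hU.nonneg
  have hθ : 0 < (1 / 2 : ℝ) ^ α := by positivity
  have hb : 1 ≤ (2 : ℝ) ^ a := Real.one_le_rpow (by norm_num) ha.le
  have hbθ : (1 / 2 : ℝ) ^ α * ((2 : ℝ) ^ a) ^ 2 < 1 := by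
    rw [one_div, Real.inv_rpow (by norm_num), ← Real.rpow_natCast _ 2,
      ← Real.rpow_mul (by norm_num), inv_mul_lt_iff₀ (by positivity), mul_one]
    exact Real.rpow_lt_rpow_of_exponent_lt (by norm_num) (by push_cast; linarith)
  obtain ⟨c, hc, g, hg, hmod⟩ := hU.exists_surjective hθ (fun m => rfl)
    (summable_mul_of_card_le hB hb hθ hbθ hcard fun m => rfl)
  refine ⟨g, hg, holderWith_of_modulus (by linarith) hc (by positivity : 0 ≤ 6 * R) ?_ hmod hr⟩
  intro s t
  have := hU.dist_le 0 Set.univ (by simp [hU.zero]) (g s) trivial (g t) trivial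
  rw [pow_zero] at this
  linarith

theorem sierpinskiFunction_ne_zero (X : Type*) [MetricSpace X] [Nonempty X] (ε : ℝ) :
    sierpinskiFunction X ε ≠ 0 := by
  intro h
  obtain ⟨𝒞, ⟨hcov, -⟩, hcard⟩ := exists_isConnectedCover (X := X) (ε := ε) (by simp [h])
  rw [h, Set.encard_eq_zero] at hcard
  simp [hcard, Set.empty_ne_univ] at hcov

theorem sDim_nonneg (X : Type*) [MetricSpace X] [Nonempty X] : 0 ≤ sDim X := by
  refine le_limsup_of_frequently_le (Eventually.frequently ?_) (by isBoundedDefault)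
  filter_upwards [self_mem_nhdsWithin,
    nhdsWithin_le_nhds (gt_mem_nhds (zero_lt_one (α := ℝ)))] with ε h0 h1
  have h0' : (0 : ℝ) < ε := h0
  have hlog : 0 ≤ Real.log (1 / ε) := Real.log_nonneg (by rw [le_div_iff₀ h0']; linarith)
  refine EReal.div_nonneg (ENNReal.zero_le_log_iff.2 ?_) (by exact_mod_cast hlog)
  have := Order.one_le_iff_ne_zero.2 (sierpinskiFunction_ne_zero X ε)
  exact_mod_cast this

theorem holderDim_le_two_mul_sDim (X : Type*) [MetricSpace X] [CompactSpace X]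
    [ConnectedSpace X] : (holderDim X : EReal) ≤ 2 * sDim X := by
  refine EReal.le_of_forall_lt_iff_le.1 fun z hz => ?_
  have hlt : sDim X < ((z / 2 : ℝ) : EReal) := by
    by_contra! hcon
    have h1 : ((2 : ℝ) : EReal) * ((z / 2 : ℝ) : EReal) ≤ 2 * sDim X :=
      mul_le_mul_of_nonneg_left hcon (by exact_mod_cast zero_le_two)
    rw [← EReal.coe_mul, mul_div_cancel₀ z two_ne_zero] at h1
    exact absurd hz h1.not_gt
  obtain ⟨a, ha, haz⟩ := EReal.lt_iff_exists_real_btwn.1 hlt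
  have ha0 : 0 < a := by exact_mod_cast (sDim_nonneg X).trans_lt ha
  have haz' : a < z / 2 := by exact_mod_cast haz
  have hz0 : 0 < z := by linarith
  have hS : ∀ᶠ ε : ℝ in 𝓝[>] 0,
      (sierpinskiFunction X ε : ℝ≥0∞) ≤ ENNReal.ofReal ((1 / ε) ^ a) := by
    filter_upwards [Filter.eventually_lt_of_limsup_lt ha, self_mem_nhdsWithin,
      nhdsWithin_le_nhds (gt_mem_nhds (zero_lt_one (α := ℝ)))] with ε hε h0 h1
    exact (log_div_log_le_iff h0 h1 a).1 hε.le
  have hr : ((1 / ENNReal.ofReal z).toNNReal : ℝ) = z⁻¹ := by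
    change (1 / ENNReal.ofReal z).toReal = _
    simp [ENNReal.toReal_ofReal hz0.le]
  have hle : holderDim X ≤ ENNReal.ofReal z :=
    sInf_le ⟨ENNReal.ofReal_pos.2 hz0, exists_surjective_holderWith ha0 (by linarith) hS hr⟩
  calc (holderDim X : EReal) ≤ (ENNReal.ofReal z : EReal) :=
        EReal.coe_ennreal_le_coe_ennreal_iff.2 hle
    _ = (z : EReal) := by rw [EReal.coe_ennreal_ofReal, max_eq_left hz0.le]

theorem corollary1p2 {X : Type*} [MetricSpace X] (hX : IsPeanoContinuum X) :
    sDim X ≤ (holderDim X : EReal) ∧ (holderDim X : EReal) ≤ 2 * sDim X := by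
  obtain ⟨-, f, hf, hsurj⟩ := hX
  have hcompact : CompactSpace X := ⟨by
    rw [← hsurj.range_eq]
    exact isCompact_range hf⟩
  have hconn : ConnectedSpace X := hsurj.connectedSpace hf
  exact ⟨sDim_le_holderDim X, holderDim_le_two_mul_sDim X⟩
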